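/- Let $k$ be a field, $n\geqslant 1$ an integer, $E$ a $k$-vector space of dimension $n+1$, and $\mathbb P(E)=\operatorname{Proj}(\operatorname{Sym}_k E)$ the projective space of rank one quotients of $E$. For a noetherian local ring $A$ of dimension $d$ with maximal ideal $\mathfrak m$, the multiplicity of $A$ is the number $e$ such that, for all sufficiently large integers $m$, the length of $A/\mathfrak m^{m+1}$ is given by a polynomial $Q(m)$ of degree at most $d$ with $Q(m)=e\,\frac{m^d}{d!}+o(m^d)$ (for $d=0$, where $o(m^d)$ is read as $0$, it is the length of $A$). For an integral closed subscheme $Y$ of a locally noetherian scheme $X$, with generic point $\eta_Y$, let $\mu_Y(X)$ denote the multiplicity of the local ring $\mathcal O_{X,\eta_Y}$. For a field extension $k'/k$ and a $k$-scheme $X$, write $X_{k'}=X\times_{\operatorname{Spec} k}\operatorname{Spec} k'$. Let $X$ be a closed subscheme of $\mathbb P(E)$, let $Y$ be an integral closed subscheme of $X$, and let $k'/k$ be a finite Galois extension of fields. Then for every irreducible component $Y'$ of $Y_{k'}$, regarded as an integral closed subscheme of $X_{k'}$ via $Y'\subseteq Y_{k'}\subseteq X_{k'}$, \[\mu_{Y'}(X_{k'})=\mu_Y(X).\]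 -/

import Mathlib

open CategoryTheory CategoryTheory.Limits AlgebraicGeometry Filter

universe u

noncomputable section

/-! ## The grading of the symmetric algebra -/

namespace SymGrading

open scoped DirectSum

section

variable (R M : Type*) [CommRing R] [AddCommGroup M] [Module R M]

/-- The degree `d` part `Sym^d M` of the symmetric algebra: the `d`-th power of the image of `M`. -/
def homogeneousPart (d : ℕ) : Submodule R (SymmetricAlgebra R M) :=
  LinearMap.range (SymmetricAlgebra.ι R M) ^ d

instance gradedMonoid : SetLike.GradedMonoid (homogeneousPart R M) :=
  Submodule.nat_power_gradedMonoid (LinearMap.range (SymmetricAlgebra.ι R M))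

theorem ι_mem (m : M) : SymmetricAlgebra.ι R M m ∈ homogeneousPart R M 1 := by
  rw [homogeneousPart, pow_one]
  exact LinearMap.mem_range_self _ m

/-- The canonical map from `M` to the direct sum of the homogeneous parts. -/
def ιDegreeOne : M →ₗ[R] ⨁ d : ℕ, homogeneousPart R M d :=
  DirectSum.lof R ℕ (fun d => homogeneousPart R M d) 1 ∘ₗ
    (SymmetricAlgebra.ι R M).codRestrict _ (ι_mem R M)

theorem ιDegreeOne_apply (m : M) :
    ιDegreeOne R M m =
      DirectSum.of (fun d : ℕ => homogeneousPart R M d) 1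
        ⟨SymmetricAlgebra.ι R M m, ι_mem R M m⟩ :=
  rfl

/-- The decomposition map of the symmetric algebra into homogeneous parts. -/
def decomposeHom : SymmetricAlgebra R M →ₐ[R] ⨁ d : ℕ, homogeneousPart R M d :=
  SymmetricAlgebra.lift (ιDegreeOne R M)

theorem decomposeHom_eq (d : ℕ) (x : homogeneousPart R M d) :
    decomposeHom R M x = DirectSum.of (fun d => homogeneousPart R M d) d x := by
  obtain ⟨x, hx⟩ := x
  dsimp only
  unfold homogeneousPart at hx
  induction hx using Submodule.pow_induction_on_left' with
  | algebraMap r =>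
    rw [AlgHom.commutes, DirectSum.algebraMap_apply]; rfl
  | add x y i hx hy ihx ihy =>
    rw [map_add, ihx, ihy, ← map_add]
    rfl
  | mem_mul m hm i x hx ih =>
    obtain ⟨_, rfl⟩ := hm
    rw [map_mul, ih, decomposeHom, SymmetricAlgebra.lift_ι_apply, ιDegreeOne_apply,
      DirectSum.of_mul_of]
    exact DirectSum.of_eq_of_gradedMonoid_eq (Sigma.subtype_ext (add_comm _ _) rfl)

/-- The symmetric algebra is graded by the submodules `Sym^d M`. -/
instance gradedAlgebra : GradedAlgebra (homogeneousPart R M) :=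
  GradedAlgebra.ofAlgHom _ (decomposeHom R M)
    (by
      apply SymmetricAlgebra.algHom_ext
      ext m
      change DirectSum.coeAlgHom (homogeneousPart R M) (decomposeHom R M (SymmetricAlgebra.ι R M m)) =
        SymmetricAlgebra.ι R M m
      rw [decomposeHom, SymmetricAlgebra.lift_ι_apply, ιDegreeOne_apply, DirectSum.coeAlgHom_of])
    (decomposeHom_eq R M)

end

end SymGrading

/-! ## Projective spaces, closed subschemes and base change -/

/-- The projective space `ℙ(E) = Proj (Sym E)` of rank one quotients of the vector space `E`. -/
def ProjSpace (k E : Type u) [Field k] [AddCommGroup E] [Module k E] : Scheme.{u} :=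
  Proj (SymGrading.homogeneousPart k E)

/-- The structure morphism `ℙ(E) ⟶ Spec k`, given by `k → Sym^0 E`. -/
def ProjSpace.toSpec (k E : Type u) [Field k] [AddCommGroup E] [Module k E] :
    ProjSpace k E ⟶ Spec (.of k) :=
  Proj.toSpecZero (SymGrading.homogeneousPart k E) ≫
    Spec.map (CommRingCat.ofHom (algebraMap k (SymGrading.homogeneousPart k E 0)))

/-- For a `k`-scheme `X` with structure morphism `s`, the fibre product
`X_{k'} = X ×_{Spec k} Spec k'`. -/
abbrev baseChange {k : Type u} [Field k] (k' : Type u) [Field k'] [Algebra k k']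
    {X : Scheme.{u}} (s : X ⟶ Spec (.of k)) : Scheme.{u} :=
  pullback s (Spec.map (CommRingCat.ofHom (algebraMap k k')))

/-- The base change `f_{k'} : Y_{k'} ⟶ X_{k'}` of a morphism `f : Y ⟶ X` of `k`-schemes, where `X`
has the structure morphism `s` and `Y` has the structure morphism `f ≫ s`. -/
def baseChangeMap {k : Type u} [Field k] (k' : Type u) [Field k'] [Algebra k k']
    {Y X : Scheme.{u}} (f : Y ⟶ X) (s : X ⟶ Spec (.of k)) :
    baseChange k' (f ≫ s) ⟶ baseChange k' s :=
  pullback.map (f ≫ s) _ s _ f (𝟙 _) (𝟙 _) (by simp) (by simp)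

/-! ## Multiplicities -/

/-- `e` is the multiplicity of the local ring `A` with maximal ideal `𝔪`: there is a polynomial `Q`
of degree at most `d = dim A` such that `length (A ⧸ 𝔪 ^ (m + 1)) = Q(m)` for all large `m`, and
`e / d!` is its coefficient in degree `d`, that is, `Q(m) = e * m ^ d / d! + o(m ^ d)`. -/
def HasMultiplicity (A : Type*) [CommRing A] [IsLocalRing A] (e : ℚ) : Prop :=
  ∃ (d : ℕ) (Q : Polynomial ℚ), ringKrullDim A = d ∧ Q.natDegree ≤ d ∧
    (∀ᶠ m : ℕ in atTop, ∃ l : ℕ,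
      Module.length A (A ⧸ IsLocalRing.maximalIdeal A ^ (m + 1)) = l ∧ Q.eval (m : ℚ) = l) ∧
    e = d.factorial * Q.coeff d

theorem HasMultiplicity.unique {A : Type*} [CommRing A] [IsLocalRing A] {e e' : ℚ}
    (h : HasMultiplicity A e) (h' : HasMultiplicity A e') : e = e' := by
  obtain ⟨d, Q, hd, -, hQ, rfl⟩ := h
  obtain ⟨d', Q', hd', -, hQ', rfl⟩ := h'
  have hdd : d = d' := by
    rw [hd] at hd'
    exact_mod_cast hd'
  subst hdd
  have hQQ : Q = Q' := by
    obtain ⟨N, hN⟩ := eventually_atTop.1 (hQ.and hQ')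
    refine Polynomial.eq_of_infinite_eval_eq Q Q' ?_
    refine Set.Infinite.mono (s := (fun m : ℕ => (m : ℚ)) '' Set.Ici N) ?_
      ((Set.Ici_infinite N).image (Nat.cast_injective.injOn))
    rintro _ ⟨m, hm, rfl⟩
    obtain ⟨⟨l, hl, hl'⟩, ⟨r, hr, hr'⟩⟩ := hN m hm
    have hlr : l = r := by
      rw [hl] at hr
      exact_mod_cast hr
    simp only [Set.mem_ofPred_eq, hl', hr', hlr]
  rw [hQQ]

open Classical in
/-- The multiplicity of a noetherian local ring `A`, i.e. the unique `e` with
`HasMultiplicity A e`. -/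
def localMultiplicity (A : Type*) [CommRing A] [IsLocalRing A] : ℚ :=
  if h : ∃ e, HasMultiplicity A e then h.choose else 0

theorem HasMultiplicity.localMultiplicity_eq {A : Type*} [CommRing A] [IsLocalRing A] {e : ℚ}
    (h : HasMultiplicity A e) : localMultiplicity A = e := by
  have h' : ∃ e, HasMultiplicity A e := ⟨e, h⟩
  rw [localMultiplicity, dif_pos h']
  exact h'.choose_spec.unique h

/-- The multiplicity `μ_Y(X)` of a scheme `X` along an integral closed subscheme `f : Y ⟶ X`: the
multiplicity of the local ring of `X` at the (image of the) generic point of `Y`. -/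
def multAlong {Y X : Scheme.{u}} [IsIntegral Y] (f : Y ⟶ X) : ℚ :=
  localMultiplicity (X.presheaf.stalk (f (genericPoint Y)))

end

/-! ## Multiplicities along extensions of local rings -/

section LocalRings

open IsLocalRing

/-! The projection `X_{k'} ⟶ X` is finite étale, being a base change of `Spec k' ⟶ Spec k`, and the
generic point of `Y'` lies over that of `Y` because generalizations lift along the flat map `Y_{k'}
⟶ Y`. The stalks thus form a flat, quasi-finite local extension `A → B` with `𝔪_A B = 𝔪_B`. Such an
extension preserves the dimension and all lengths of `A ⧸ 𝔪_A ^ n`, hence the multiplicity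
(`localMultiplicity_eq_of_flat`). -/

/-- The Krull dimension does not grow along a quasi-finite extension. -/
theorem ringKrullDim_le_of_quasiFinite (A B : Type*) [CommRing A] [CommRing B] [Algebra A B]
    [Algebra.QuasiFinite A B] : ringKrullDim B ≤ ringKrullDim A := by
  refine Order.krullDim_le_of_strictMono (PrimeSpectrum.comap (algebraMap A B)) fun p q hpq ↦ ?_
  have hle : PrimeSpectrum.comap (algebraMap A B) p ≤ PrimeSpectrum.comap (algebraMap A B) q :=
    Ideal.comap_mono hpq.le
  refine hle.lt_of_ne fun h ↦ hpq.ne (PrimeSpectrum.ext ?_)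
  -- Incomparability: nested primes with the same contraction coincide.
  exact Algebra.QuasiFinite.eq_of_le_of_under_eq (R := A) p.asIdeal q.asIdeal hpq.le
    (congrArg PrimeSpectrum.asIdeal h)

variable {A B : Type*} [CommRing A] [CommRing B] [IsLocalRing A] [IsLocalRing B] [Algebra A B]
  [IsLocalHom (algebraMap A B)] [Module.Flat A B]

/-- The Krull dimension does not drop along a flat local extension of local rings. -/
theorem ringKrullDim_le_of_flat_of_isLocalHom : ringKrullDim A ≤ ringKrullDim B := by
  have : Module.FaithfullyFlat A B := .of_flat_of_isLocalHom
  refine iSup_le fun l ↦ ?_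
  -- Faithful flatness lifts the top of the chain; going down then lifts the rest below it.
  obtain ⟨Q, hQ⟩ := PrimeSpectrum.comap_surjective_of_faithfullyFlat (B := B) l.last
  have : Q.asIdeal.LiesOver l.last.asIdeal := ⟨(congrArg PrimeSpectrum.asIdeal hQ).symm⟩
  obtain ⟨L, hL, -⟩ := Ideal.exists_ltSeries_of_hasGoingDown l Q.asIdeal
  rw [← hL]
  exact Order.LTSeries.length_le_krullDim L

open TensorProduct in
/-- If `B` is a flat extension of the local ring `A` whose maximal ideal is generated by that
of `A`, then `B ⧸ 𝔪_B ^ n` and `A ⧸ 𝔪_A ^ n` have the same length. -/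
theorem length_quotient_maximalIdeal_pow_eq
    (h : (maximalIdeal A).map (algebraMap A B) = maximalIdeal B) (n : ℕ) :
    Module.length B (B ⧸ maximalIdeal B ^ n) = Module.length A (A ⧸ maximalIdeal A ^ n) := by
  have hsimple : Module.length B (B ⧸ maximalIdeal B) = 1 :=
    Module.length_eq_one_iff.mpr (isSimpleModule_iff_isCoatom.mpr (maximalIdeal.isMaximal B).out)
  have e := (Algebra.TensorProduct.quotIdealMapEquivTensorQuot B
    (maximalIdeal A ^ n)).toLinearEquiv.length_eq
  -- Flat base change multiplies length by that of the closed fibre `B ⧸ 𝔪_A B`, here the residue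
  -- field of `B`.
  rw [IsLocalRing.length_baseChange, h, hsimple, mul_one, Ideal.map_pow, h] at e
  exact e

theorem hasMultiplicity_iff_of_flat [Algebra.QuasiFinite A B]
    (h : (maximalIdeal A).map (algebraMap A B) = maximalIdeal B) (e : ℚ) :
    HasMultiplicity B e ↔ HasMultiplicity A e := by
  have hdim : ringKrullDim B = ringKrullDim A :=
    (ringKrullDim_le_of_quasiFinite A B).antisymm ringKrullDim_le_of_flat_of_isLocalHom
  simp only [HasMultiplicity, hdim, length_quotient_maximalIdeal_pow_eq h]

theorem localMultiplicity_eq_of_flat [Algebra.QuasiFinite A B]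
    (h : (maximalIdeal A).map (algebraMap A B) = maximalIdeal B) :
    localMultiplicity B = localMultiplicity A := by
  have heq : HasMultiplicity B = HasMultiplicity A :=
    funext fun e ↦ propext (hasMultiplicity_iff_of_flat h e)
  rw [localMultiplicity, localMultiplicity, heq]

end LocalRings

/-! ## Multiplicities along étale morphisms -/

section Schemes

open IsLocalRing

/-- On affine charts, `R → R_p → S_q` equals `R → S → S_q`, a composite of quasi-finite maps, so its
second factor `R_p → S_q` is quasi-finite. -/
theorem LocallyQuasiFinite.quasiFinite_stalkMap {X Y : Scheme.{u}} (f : X ⟶ Y)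
    [LocallyQuasiFinite f] (x : X) : (f.stalkMap x).hom.QuasiFinite := by
  refine HasRingHomProperty.stalkMap (P := @LocallyQuasiFinite) (fun {R S} _ _ g hg J _ ↦ ?_) ‹_› x
  refine RingHom.QuasiFinite.of_comp (g := algebraMap R (Localization.AtPrime (J.comap g))) ?_
  have hcomp : (Localization.localRingHom _ J g rfl).comp
      (algebraMap R (Localization.AtPrime (J.comap g))) =
      (algebraMap S (Localization.AtPrime J)).comp g :=
    RingHom.ext fun r ↦ Localization.localRingHom_to_map _ _ _ rfl r
  rw [hcomp]
  exact .comp ((RingHom.quasiFinite_algebraMap).mpr (.of_isLocalization J.primeCompl)) hg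

theorem localMultiplicity_stalk_eq_of_etale {X Y : Scheme.{u}} (f : X ⟶ Y) [Etale f]
    [LocallyQuasiFinite f] {x : X} {y : Y} (hxy : f x = y) :
    localMultiplicity (X.presheaf.stalk x) = localMultiplicity (Y.presheaf.stalk y) := by
  subst hxy
  algebraize [(f.stalkMap x).hom]
  have : IsLocalHom (algebraMap (Y.presheaf.stalk (f x)) (X.presheaf.stalk x)) :=
    inferInstanceAs <| IsLocalHom (f.stalkMap x).hom
  have : Module.Flat (Y.presheaf.stalk (f x)) (X.presheaf.stalk x) := Flat.stalkMap f x
  have : Algebra.QuasiFinite (Y.presheaf.stalk (f x)) (X.presheaf.stalk x) :=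
    LocallyQuasiFinite.quasiFinite_stalkMap f x
  -- Together with unramifiedness, this yields `𝔪_A B = 𝔪_B`.
  have : Algebra.EssFiniteType (Y.presheaf.stalk (f x)) (X.presheaf.stalk x) := by
    rw [← RingHom.essFiniteType_algebraMap, RingHom.algebraMap_toAlgebra]
    exact LocallyOfFiniteType.stalkMap f x
  have : Algebra.FormallyUnramified (Y.presheaf.stalk (f x)) (X.presheaf.stalk x) :=
    FormallyUnramified.stalkMap f x
  exact localMultiplicity_eq_of_flat Algebra.FormallyUnramified.map_maximalIdeal

/-- A flat morphism to an integral scheme maps generic points of irreducible components to the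
generic point. -/
theorem apply_eq_genericPoint_of_flat {X Y : Scheme.{u}} (f : X ⟶ Y) [Flat f] [IsIntegral Y]
    {x : X} (hx : closure {x} ∈ irreducibleComponents X) : f x = genericPoint Y := by
  obtain ⟨z, hz, hfz⟩ := Flat.generalizingMap f (genericPoint_specializes (f x))
  have hle : closure {x} ⊆ closure {z} := hz.closure_subset
  -- The lift `z` of the generic point specializes to `x`, so maximality of the component forces `z
  -- = x`.
  have heq : closure {z} = closure {x} :=
    (hx.2 isIrreducible_singleton.closure hle).antisymm hle
  have hxz : x = z := (isGenericPoint_closure (x := x)).eq heq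
  rw [hxz, hfz]

theorem etale_SpecMap_of_isSeparable (k k' : Type u) [Field k] [Field k'] [Algebra k k']
    [FiniteDimensional k k'] [Algebra.IsSeparable k k'] :
    Etale (Spec.map (CommRingCat.ofHom (algebraMap k k'))) := by
  rw [HasRingHomProperty.Spec_iff (P := @Etale), CommRingCat.hom_ofHom, RingHom.etale_algebraMap]
  have := Algebra.FormallyEtale.of_isSeparable k k'
  exact ⟨inferInstance, Algebra.FinitePresentation.of_finiteType.mp inferInstance⟩

theorem multAlong_irreducibleComponent_baseChange {k : Type u} [Field k]
    {X : Scheme.{u}} (s : X ⟶ Spec (.of k)) {Y : Scheme.{u}} [IsIntegral Y] (j : Y ⟶ X)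
    {k' : Type u} [Field k'] [Algebra k k'] [FiniteDimensional k k'] [Algebra.IsSeparable k k']
    {Y' : Scheme.{u}} [IsIntegral Y'] (ι : Y' ⟶ baseChange k' (j ≫ s)) [IsClosedImmersion ι]
    (hY' : Set.range ι ∈ irreducibleComponents (baseChange k' (j ≫ s))) :
    multAlong (ι ≫ baseChangeMap k' j s) = multAlong j := by
  have := etale_SpecMap_of_isSeparable k k'
  have : IsFinite (Spec.map (CommRingCat.ofHom (algebraMap k k'))) := by
    rw [IsFinite.SpecMap_iff, CommRingCat.hom_ofHom, RingHom.finite_algebraMap]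
    infer_instance
  have hcl : closure {ι (genericPoint Y')} = Set.range ι := by
    have h := (genericPoint_spec Y').image ι.continuous
    rwa [Set.image_univ, IsGenericPoint, ι.isClosedEmbedding.isClosed_range.closure_eq] at h
  have hgen := apply_eq_genericPoint_of_flat
    (pullback.fst (j ≫ s) (Spec.map (CommRingCat.ofHom (algebraMap k k')))) (hcl ▸ hY')
  have hcomp : (ι ≫ baseChangeMap k' j s) ≫ pullback.fst s _ = (ι ≫ pullback.fst _ _) ≫ j := by
    rw [Category.assoc, Category.assoc]
    exact congrArg (ι ≫ ·) (pullback.lift_fst _ _ _)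
  have hpt : pullback.fst s (Spec.map (CommRingCat.ofHom (algebraMap k k')))
      ((ι ≫ baseChangeMap k' j s) (genericPoint Y')) = j (genericPoint Y) := by
    rw [← Scheme.Hom.comp_apply, hcomp, Scheme.Hom.comp_apply, Scheme.Hom.comp_apply, hgen]
  exact localMultiplicity_stalk_eq_of_etale _ hpt

end Schemes

theorem mainTheorem6 {k : Type u} [Field k] (n : ℕ) (hn : 1 ≤ n)
    {E : Type u} [AddCommGroup E] [Module k E] (hE : Module.finrank k E = n + 1)
    {X : Scheme.{u}} (i : X ⟶ ProjSpace k E) [IsClosedImmersion i]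
    {Y : Scheme.{u}} [IsIntegral Y] (j : Y ⟶ X) [IsClosedImmersion j]
    {k' : Type u} [Field k'] [Algebra k k'] [FiniteDimensional k k'] [IsGalois k k']
    {Y' : Scheme.{u}} [IsIntegral Y']
    (ι : Y' ⟶ baseChange k' (j ≫ i ≫ ProjSpace.toSpec k E)) [IsClosedImmersion ι]
    (hY' : Set.range ι ∈
      irreducibleComponents (baseChange k' (j ≫ i ≫ ProjSpace.toSpec k E))) :
    multAlong (ι ≫ baseChangeMap k' j (i ≫ ProjSpace.toSpec k E)) = multAlong j :=
  multAlong_irreducibleComponent_baseChange (i ≫ ProjSpace.toSpec k E) j ι hY'
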